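/- Let $p$ be an odd prime and let $\alpha,\beta\in\mathbb Z_p$. For $x\in\mathbb Z_p$ let $\langle x\rangle_p\in\{0,1,\dots,p-1\}$ be the least nonnegative residue of $x$ modulo $p$, and put $x^*=(x+\langle -x\rangle_p)/p\in\mathbb Z_p$. Let $\Gamma_p$ be Morita's $p$-adic Gamma function, i.e. $\Gamma_p(n)=(-1)^n\prod_{1\le k<n,\;p\nmid k}k$ for integers $n\ge 0$ (so $\Gamma_p(0)=1$), extended to $\mathbb Z_p$ by $\Gamma_p(x)=\lim_{n\in\mathbb N,\;|x-n|_p\to0}\Gamma_p(n)$. Let $${}_3F_2\bigg[\begin{matrix}\alpha&\beta&1-\alpha-\beta\\&1&1\end{matrix}\bigg|\,1\bigg]_{p-1}=\sum_{k=0}^{p-1}\frac{(\alpha)_k(\beta)_k(1-\alpha-\beta)_k}{(1)_k(1)_k\,k!},$$ where $(x)_k=x(x+1)\cdots(x+k-1)$ and $(x)_0=1$. (i) If $p\ne 3$ and $\langle-\alpha\rangle_p+\langle-\beta\rangle_p\le p-1$, then $${}_3F_2\bigg[\begin{matrix}\alpha&\beta&1-\alpha-\beta\\&1&1\end{matrix}\bigg|\,1\bigg]_{p-1}\equiv\frac{\Gamma_p(1-\alpha-\beta)^2}{\Gamma_p(1-\alpha)^2\,\Gamma_p(1-\beta)^2}\pmod{p^3}.$$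 (ii) If $\langle-\alpha\rangle_p+\langle-\beta\rangle_p\ge p$, then $${}_3F_2\bigg[\begin{matrix}\alpha&\beta&1-\alpha-\beta\\&1&1\end{matrix}\bigg|\,1\bigg]_{p-1}\equiv p^2\big((\alpha^*-1)^2+(\beta^*-1)^2+\alpha^*\beta^*-1\big)\cdot\frac{\Gamma_p(1-\alpha-\beta)^2}{\Gamma_p(1-\alpha)^2\,\Gamma_p(1-\beta)^2}\pmod{p^3}.$$ -/

import Mathlib

/-- The truncated hypergeometric series
`∑_{k=0}^{n} (a₀)_k ⋯ (a_r)_k / ((b₁)_k ⋯ (b_r)_k) * z^k / k!`. -/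
noncomputable def truncHypergeometric {K : Type*} [Field K] {r : ℕ}
    (a : Fin (r + 1) → K) (b : Fin r → K) (z : K) (n : ℕ) : K :=
  ∑ k ∈ Finset.range (n + 1),
    (∏ i, (ascPochhammer K k).eval (a i)) / (∏ j, (ascPochhammer K k).eval (b j)) *
      (z ^ k / (k.factorial : K))

/-- Morita's function at natural numbers: `(-1)^n ∏_{1 ≤ k < n, p ∤ k} k`
(which is `1` at `n = 0`). -/
def moritaGammaNat (p n : ℕ) : ℤ :=
  (-1) ^ n * ∏ k ∈ Finset.Ico 1 n with ¬ p ∣ k, (k : ℤ)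

/-- Morita's `p`-adic Gamma function: the limit of `moritaGammaNat p n` as the natural number `n`
tends `p`-adically to `x`. -/
noncomputable def moritaGamma (p : ℕ) [Fact p.Prime] (x : ℤ_[p]) : ℤ_[p] :=
  Filter.limUnder (Filter.comap (fun n : ℕ => (n : ℤ_[p])) (nhds x))
    (fun n : ℕ => (moritaGammaNat p n : ℤ_[p]))

/-- `x* = (x + ⟨-x⟩_p) / p`, where `⟨y⟩_p = y.zmodRepr` is the least nonnegative residue. -/
noncomputable def padicDash {p : ℕ} [Fact p.Prime] (x : ℤ_[p]) : ℚ_[p] :=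
  ((x : ℚ_[p]) + ((-x).zmodRepr : ℚ_[p])) / (p : ℚ_[p])

/-- `x ≡ y (mod p^n)`: the difference lies in `p^n ℤ_p`. -/
def PadicCongrMod {p : ℕ} [Fact p.Prime] (n : ℕ) (x y : ℚ_[p]) : Prop :=
  ∃ z : ℤ_[p], x - y = (p : ℚ_[p]) ^ n * (z : ℚ_[p])

open Finset Filter Topology

/-!
Put `γ = 1 - α - β`. When `α = -a` with `0 ≤ a < p`, the truncated series terminates on its own and
the Pfaff–Saalschütz theorem evaluates it exactly; by the functional equation and the reflection
formula of `Γ_p` its value is `(Γ_p(α) Γ_p(β) Γ_p(γ))²`, times `p² (1 - β*)²` in case (ii).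

In general write `α = -a + p x` and `β = -b + p y`, so that `γ = 1 + a + b - p (x + y)`. Modulo `p³`
both sides are polynomials in `p x` and `p y`. If `F` is their difference, then
`F(x, y) - F(x, 0) - F(0, y) + F(0, 0)` is congruent to `p² x y` times a constant. Both sides are
symmetric in `α`, `β`, `γ`, so `F` vanishes on the lines `x = 0` and `y = 0` and also wherever
`-γ ∈ {0, …, p - 1}`; one point of the last kind with `x y` a unit makes the constant divisible
by `p`.

For `p ≥ 5`, that `Γ_p` is polynomial modulo `p³` on `m + p ℤ_p` comes from its difference equation
with step `p`: `Γ_p(t + p) = -Γ_p(t) ∏ (t + k)`, the product running over the `k < p` with `t + k`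
a unit. In case (ii) the factor `p²` leaves only `Γ_p` modulo `p`, which is constant there.
-/

/-! ### The Pfaff–Saalschütz theorem -/

section Saalschutz

variable {K : Type*} [Field K]

theorem ascPochhammer_eval_ne_zero {c : K} (hc : ∀ k : ℕ, c + k ≠ 0) (n : ℕ) :
    (ascPochhammer K n).eval c ≠ 0 := by
  rw [ne_eq, ascPochhammer_eval_eq_zero_iff]
  rintro ⟨k, -, hk⟩
  exact hc k (by rw [hk, add_neg_cancel])

theorem ascPochhammer_succ_eval_left {R : Type*} [CommSemiring R] (n : ℕ) (x : R) :
    (ascPochhammer R (n + 1)).eval x = x * (ascPochhammer R n).eval (x + 1) := by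
  simp [ascPochhammer_succ_left]

/-- The general term of the Saalschützian series `₃F₂(-a, b, e; c, d; 1)`, where
`e = c + d + a - b - 1` makes the lower parameters exceed the upper ones by `1` in total. -/
noncomputable def saalschutzTerm (a b c d : K) (k : ℕ) : K :=
  (ascPochhammer K k).eval (-a) * (ascPochhammer K k).eval b *
      (ascPochhammer K k).eval (c + d + a - b - 1) /
    ((ascPochhammer K k).eval c * (ascPochhammer K k).eval d * k.factorial)

theorem saalschutzTerm_zero (a b c d : K) : saalschutzTerm a b c d 0 = 1 := by
  simp [saalschutzTerm]

variable [CharZero K]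

-- A certificate of creative telescoping in `a`.
theorem sum_saalschutzTerm_telescope {c d : K} (hc : ∀ k : ℕ, c + k ≠ 0)
    (hd : ∀ k : ℕ, d + k ≠ 0) (a b : K) (m : ℕ) :
    ∑ k ∈ range (m + 1), ((c + a) * (d + a) * saalschutzTerm (a + 1) b c d k -
        (c + a - b) * (d + a - b) * saalschutzTerm a b c d k) =
      (c + d + 2 * a - b) * (ascPochhammer K m).eval (-a) * (ascPochhammer K (m + 1)).eval b *
        (ascPochhammer K m).eval (c + d + a - b) /
        ((ascPochhammer K m).eval c * (ascPochhammer K m).eval d * m.factorial) := by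
  induction m with
  | zero =>
    simp only [zero_add, sum_range_one, saalschutzTerm_zero, ascPochhammer_zero,
      ascPochhammer_one, Polynomial.eval_one, Polynomial.eval_X, Nat.factorial_zero,
      Nat.cast_one]
    ring
  | succ m ih =>
    have hc' := ascPochhammer_eval_ne_zero hc m
    have hd' := ascPochhammer_eval_ne_zero hd m
    have hm : (m.factorial : K) ≠ 0 := by exact_mod_cast m.factorial_ne_zero
    have hm' : (m + 1 : K) ≠ 0 := by exact_mod_cast m.succ_ne_zero
    have hcm := hc m
    have hdm := hd m
    rw [sum_range_succ, ih, saalschutzTerm, saalschutzTerm,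
      ascPochhammer_succ_eval_left m (-(a + 1)),
      ascPochhammer_succ_eval_left m (c + d + a - b - 1),
      show -(a + 1) + 1 = -a by ring, show c + d + a - b - 1 + 1 = c + d + a - b by ring,
      show c + d + (a + 1) - b - 1 = c + d + a - b by ring,
      ascPochhammer_succ_eval (m + 1) b, ascPochhammer_succ_eval m (-a),
      ascPochhammer_succ_eval m (c + d + a - b), ascPochhammer_succ_eval m c,
      ascPochhammer_succ_eval m d, Nat.factorial_succ]
    push_cast
    field_simp
    ring

theorem sum_saalschutzTerm {c d : K} (hc : ∀ k : ℕ, c + k ≠ 0) (hd : ∀ k : ℕ, d + k ≠ 0)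
    (b : K) {n m : ℕ} (hnm : n < m) :
    ∑ k ∈ range m, saalschutzTerm (n : K) b c d k =
      (ascPochhammer K n).eval (c - b) * (ascPochhammer K n).eval (d - b) /
        ((ascPochhammer K n).eval c * (ascPochhammer K n).eval d) := by
  obtain ⟨m, rfl⟩ : ∃ l, m = l + 1 := ⟨m - 1, by omega⟩
  induction n with
  | zero =>
    rw [sum_range_succ', saalschutzTerm_zero, sum_eq_zero fun k _ => ?_]
    · simp
    · simp [saalschutzTerm, ascPochhammer_succ_left]
  | succ n ih =>
    have key := sum_saalschutzTerm_telescope hc hd (n : K) b m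
    rw [ascPochhammer_eval_neg_coe_nat_of_lt (by omega : n < m), mul_zero, zero_mul, zero_mul,
      zero_div, sum_sub_distrib, ← mul_sum, ← mul_sum, ih (by omega), sub_eq_zero] at key
    have hc' := ascPochhammer_eval_ne_zero hc n
    have hd' := ascPochhammer_eval_ne_zero hd n
    have hcn := hc n
    have hdn := hd n
    push_cast
    apply mul_left_cancel₀ (mul_ne_zero hcn hdn)
    rw [key]
    simp only [ascPochhammer_succ_eval]
    field_simp
    ring

end Saalschutz

/-! ### The `p`-adic Gamma function -/

section Wilson

theorem sq_eq_one_iff_of_isUnit_two {R : Type*} [CommRing R] [IsLocalRing R]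
    (h2 : IsUnit (2 : R)) {u : R} : u ^ 2 = 1 ↔ u = 1 ∨ u = -1 := by
  refine ⟨fun h => ?_, by rintro (rfl | rfl) <;> simp⟩
  have hprod : (u + 1) * (u - 1) = 0 := by linear_combination h
  have hsum : IsUnit ((u + 1) + (1 - u)) := by convert h2 using 1; ring
  rcases IsLocalRing.isUnit_or_isUnit_of_isUnit_add hsum with hu | hu
  · exact .inl (sub_eq_zero.mp (hu.mul_right_eq_zero.mp hprod))
  · rw [← neg_sub, IsUnit.neg_iff] at hu
    exact .inr (eq_neg_of_add_eq_zero_left (hu.mul_left_eq_zero.mp hprod))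

theorem prod_univ_units_eq_neg_one {R : Type*} [CommRing R] [IsLocalRing R] [Fintype Rˣ]
    (h2 : IsUnit (2 : R)) : ∏ u : Rˣ, u = -1 := by
  classical
  have hpairs : ∏ u ∈ univ.erase (-1 : Rˣ), u = 1 := by
    refine prod_involution (fun u _ => u⁻¹) (by simp) (fun u hu hne heq => ?_)
      (fun u hu => ?_) (by simp)
    · have hsq : (u : R) ^ 2 = 1 := by
        rw [← Units.val_pow_eq_pow_val, sq, mul_eq_one_iff_eq_inv.mpr heq.symm, Units.val_one]
      rcases (sq_eq_one_iff_of_isUnit_two h2).mp hsq with h | h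
      · exact hne (Units.ext h)
      · exact ne_of_mem_erase hu (Units.ext h)
    · simpa [inv_eq_iff_eq_inv] using hu
  rw [← mul_prod_erase univ _ (mem_univ (-1)), hpairs, mul_one]

open Classical in
/-- The element `x` itself when it is a unit, and `1` otherwise: the factor contributed by `x`
to a product restricted to the units. -/
noncomputable def unitPart {M : Type*} [Monoid M] (x : M) : M := if IsUnit x then x else 1

theorem unitPart_of_isUnit {M : Type*} [Monoid M] {x : M} (hx : IsUnit x) : unitPart x = x :=
  if_pos hx

theorem unitPart_of_not_isUnit {M : Type*} [Monoid M] {x : M} (hx : ¬ IsUnit x) :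
    unitPart x = 1 :=
  if_neg hx

theorem prod_unitPart {M : Type*} [CommMonoid M] [Fintype M] [Fintype Mˣ] :
    ∏ x : M, unitPart x = ∏ u : Mˣ, (u : M) := by
  classical
  symm
  refine prod_of_injOn Units.val Units.val_injective.injOn (by simp) (fun x _ hx => ?_)
    fun u _ => (unitPart_of_isUnit u.isUnit).symm
  exact unitPart_of_not_isUnit fun ⟨u, hu⟩ => hx ⟨u, by simp, hu⟩

theorem unitPart_neg_sq {R : Type*} [Ring R] (x : R) : unitPart (-x) ^ 2 = unitPart x ^ 2 := by
  by_cases h : IsUnit x <;> simp [unitPart, h]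

end Wilson

theorem prod_range_natCast_zmod {M : Type*} [CommMonoid M] (n : ℕ) [NeZero n] (f : ZMod n → M) :
    ∏ i ∈ range n, f i = ∏ x : ZMod n, f x := by
  obtain ⟨n, rfl⟩ := Nat.exists_eq_succ_of_ne_zero (NeZero.ne n)
  rw [prod_range]
  exact Fintype.prod_congr _ _ fun i => congrArg f (Fin.cast_val_eq_self i)

section MoritaGammaNat

variable {p : ℕ}

theorem moritaGammaNat_zero : moritaGammaNat p 0 = 1 := by simp [moritaGammaNat]

variable {R : Type*} [CommRing R]

theorem moritaGammaNat_succ (hR : ∀ n : ℕ, IsUnit (n : R) ↔ ¬ p ∣ n) (n : ℕ) :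
    (moritaGammaNat p (n + 1) : R) = -unitPart (n : R) * moritaGammaNat p n := by
  rcases n.eq_zero_or_pos with rfl | hn
  · have h0 : unitPart ((0 : ℕ) : R) = 1 :=
      unitPart_of_not_isUnit ((hR 0).not.mpr (not_not.mpr (dvd_zero p)))
    rw [h0]
    simp [moritaGammaNat]
  · rw [moritaGammaNat, moritaGammaNat, prod_filter, prod_filter, prod_Ico_succ_top hn, unitPart]
    by_cases h : p ∣ n <;> simp [hR, h, pow_succ, mul_comm, mul_left_comm]

theorem moritaGammaNat_add (hR : ∀ n : ℕ, IsUnit (n : R) ↔ ¬ p ∣ n) (n m : ℕ) :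
    (moritaGammaNat p (n + m) : R) =
      (-1) ^ m * (∏ i ∈ range m, unitPart ((n : R) + i)) * moritaGammaNat p n := by
  induction m with
  | zero => simp
  | succ m ih =>
    rw [← add_assoc, moritaGammaNat_succ hR, ih, prod_range_succ]
    push_cast
    ring

variable [Fact p.Prime]

theorem isLocalRing_zmod_prime_pow {N : ℕ} (hN : N ≠ 0) : IsLocalRing (ZMod (p ^ N)) :=
  have : Fact (1 < p ^ N) := ⟨Nat.one_lt_pow hN (Fact.out : p.Prime).one_lt⟩
  .of_surjective' (PadicInt.toZModPow (p := p) N) (ZMod.ringHom_surjective _)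

theorem isUnit_natCast_zmod_prime_pow {N : ℕ} (hN : N ≠ 0) (n : ℕ) :
    IsUnit (n : ZMod (p ^ N)) ↔ ¬ p ∣ n := by
  rw [ZMod.isUnit_iff_coprime, Nat.coprime_pow_right_iff (Nat.pos_of_ne_zero hN),
    Nat.coprime_comm, (Fact.out : p.Prime).coprime_iff_not_dvd]

theorem not_prime_dvd_two (hp : Odd p) : ¬ p ∣ 2 := fun h =>
  Nat.not_odd_iff_even.mpr even_two <|
    (Nat.prime_dvd_prime_iff_eq Fact.out Nat.prime_two).mp h ▸ hp

theorem moritaGammaNat_add_prime_pow (hp : Odd p) (n N : ℕ) :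
    (moritaGammaNat p (n + p ^ N) : ZMod (p ^ N)) = moritaGammaNat p n := by
  rcases eq_or_ne N 0 with rfl | hN
  · exact (ZMod.subsingleton_iff.mpr (pow_zero p)).elim _ _
  have : NeZero (p ^ N) := ⟨pow_ne_zero _ (Fact.out : p.Prime).ne_zero⟩
  have := isLocalRing_zmod_prime_pow (p := p) hN
  have hunit := isUnit_natCast_zmod_prime_pow (p := p) hN
  have wilson : ∏ u : (ZMod (p ^ N))ˣ, (u : ZMod (p ^ N)) = -1 := by
    rw [← Units.coe_prod, prod_univ_units_eq_neg_one ((hunit 2).mpr (not_prime_dvd_two hp)),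
      Units.val_neg, Units.val_one]
  rw [moritaGammaNat_add hunit, prod_range_natCast_zmod (p ^ N) fun x => unitPart (n + x),
    Fintype.prod_equiv (Equiv.addLeft (n : ZMod (p ^ N))) (fun x => unitPart (n + x)) unitPart
      fun _ => rfl, prod_unitPart, wilson, hp.pow.neg_one_pow, neg_mul_neg, one_mul, one_mul]

theorem moritaGammaNat_eq_of_natCast_eq (hp : Odd p) {N m n : ℕ}
    (h : (m : ZMod (p ^ N)) = n) :
    (moritaGammaNat p m : ZMod (p ^ N)) = moritaGammaNat p n := by
  have hper : Function.Periodic (fun k => (moritaGammaNat p k : ZMod (p ^ N))) (p ^ N) :=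
    fun k => moritaGammaNat_add_prime_pow hp k N
  rw [← hper.map_mod_nat m, ← hper.map_mod_nat n, (ZMod.natCast_eq_natCast_iff' m n _).mp h]

end MoritaGammaNat

section PadicInt

variable {p : ℕ} [Fact p.Prime]

theorem norm_le_norm_iff_dvd {x y : ℤ_[p]} : ‖x‖ ≤ ‖y‖ ↔ y ∣ x := by
  refine ⟨fun h => ?_, ?_⟩
  · rcases eq_or_ne y 0 with rfl | hy
    · exact (norm_le_zero_iff.mp (h.trans_eq norm_zero)).symm ▸ dvd_rfl
    · have hy' : (y : ℚ_[p]) ≠ 0 := by simpa using hy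
      have hxy : ‖(x : ℚ_[p]) / y‖ ≤ 1 := by
        rw [norm_div]
        exact div_le_one_of_le₀ h (norm_nonneg _)
      exact ⟨⟨x / y, hxy⟩, Subtype.ext (mul_div_cancel₀ _ hy').symm⟩
  · rintro ⟨z, rfl⟩
    rw [norm_mul]
    exact mul_le_of_le_one_right (norm_nonneg _) z.norm_le_one

theorem dvd_of_forall_prime_pow_dvd {x y : ℤ_[p]}
    (h : ∀ N : ℕ, (p : ℤ_[p]) ^ N ∣ y → (p : ℤ_[p]) ^ N ∣ x) : y ∣ x := by
  by_contra hyx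
  rw [← norm_le_norm_iff_dvd, not_le] at hyx
  have hx : x ≠ 0 := norm_pos_iff.mp ((norm_nonneg y).trans_lt hyx)
  have hdvd (z : ℤ_[p]) : (p : ℤ_[p]) ^ (x.valuation + 1) ∣ z ↔ ‖z‖ < ‖x‖ := by
    rw [← Ideal.mem_span_singleton, ← PadicInt.norm_le_pow_iff_mem_span_pow,
      PadicInt.norm_le_pow_iff_norm_lt_pow_add_one, PadicInt.norm_eq_zpow_neg_valuation hx,
      Nat.cast_succ, neg_add, neg_add_cancel_right]
  exact lt_irrefl _ ((hdvd x).mp (h _ ((hdvd y).mpr hyx)))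

theorem lipschitzWith_one_of_sub_dvd {f : ℤ_[p] → ℤ_[p]} (h : ∀ x y, x - y ∣ f x - f y) :
    LipschitzWith 1 f :=
  .mk_one fun x y => by simpa only [dist_eq_norm] using norm_le_norm_iff_dvd.mpr (h x y)

theorem isUnit_natCast_padicInt (n : ℕ) : IsUnit (n : ℤ_[p]) ↔ ¬ p ∣ n := by
  rw [PadicInt.isUnit_iff, PadicInt.norm_natCast_eq_one_iff,
    (Fact.out : p.Prime).coprime_iff_not_dvd]

theorem isUnit_iff_not_prime_dvd {x : ℤ_[p]} : IsUnit x ↔ ¬ (p : ℤ_[p]) ∣ x := by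
  rw [← not_iff_not, not_not, PadicInt.not_isUnit_iff, PadicInt.norm_lt_one_iff_dvd]

theorem isUnit_iff_of_prime_dvd_sub {x y : ℤ_[p]} (h : (p : ℤ_[p]) ∣ x - y) :
    IsUnit x ↔ IsUnit y := by
  rw [isUnit_iff_not_prime_dvd, isUnit_iff_not_prime_dvd, dvd_iff_dvd_of_dvd_sub h]

theorem sub_dvd_unitPart_sub (x y : ℤ_[p]) : x - y ∣ unitPart x - unitPart y := by
  by_cases hxy : IsUnit (x - y)
  · exact hxy.dvd
  · rw [isUnit_iff_not_prime_dvd, not_not] at hxy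
    by_cases hy : IsUnit y
    · rw [unitPart_of_isUnit hy, unitPart_of_isUnit ((isUnit_iff_of_prime_dvd_sub hxy).mpr hy)]
    · rw [unitPart_of_not_isUnit hy,
        unitPart_of_not_isUnit ((isUnit_iff_of_prime_dvd_sub hxy).not.mpr hy), sub_self]
      exact dvd_zero _

theorem continuous_unitPart : Continuous (unitPart : ℤ_[p] → ℤ_[p]) :=
  (lipschitzWith_one_of_sub_dvd sub_dvd_unitPart_sub).continuous

end PadicInt

section MoritaGamma

variable {p : ℕ} [Fact p.Prime]

theorem natCast_sub_dvd_moritaGammaNat_sub (hp : Odd p) (m n : ℕ) :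
    (m - n : ℤ_[p]) ∣ moritaGammaNat p m - moritaGammaNat p n := by
  have hZMod (N : ℕ) (k : ℤ) : (p : ℤ_[p]) ^ N ∣ k ↔ (k : ZMod (p ^ N)) = 0 := by
    rw [PadicInt.pow_p_dvd_int_iff, ZMod.intCast_zmod_eq_zero_iff_dvd, Nat.cast_pow]
  refine dvd_of_forall_prime_pow_dvd fun N h => ?_
  have hmn : (m : ZMod (p ^ N)) = n := by
    simpa [sub_eq_zero] using (hZMod N (m - n)).mp (by simpa using h)
  simpa using (hZMod N (moritaGammaNat p m - moritaGammaNat p n)).mpr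
    (by simp [moritaGammaNat_eq_of_natCast_eq hp hmn])

theorem uniformContinuous_moritaGammaNat (hp : Odd p) :
    @UniformContinuous ℕ ℤ_[p] (.comap (Nat.cast : ℕ → ℤ_[p]) inferInstance) _
      fun n => (moritaGammaNat p n : ℤ_[p]) := by
  let : UniformSpace ℕ := .comap (Nat.cast : ℕ → ℤ_[p]) inferInstance
  have hbasis : (uniformity ℕ).HasBasis (0 < ·)
      fun ε => {mn : ℕ × ℕ | dist (mn.1 : ℤ_[p]) mn.2 < ε} :=
    Metric.uniformity_basis_dist.comap _
  refine (hbasis.uniformContinuous_iff Metric.uniformity_basis_dist).mpr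
    fun ε hε => ⟨ε, hε, fun m n hmn => ?_⟩
  suffices dist (moritaGammaNat p m : ℤ_[p]) (moritaGammaNat p n) ≤ dist (m : ℤ_[p]) n from
    this.trans_lt hmn
  rw [dist_eq_norm, dist_eq_norm, norm_le_norm_iff_dvd]
  exact natCast_sub_dvd_moritaGammaNat_sub hp m n

theorem moritaGamma_natCast (hp : Odd p) (n : ℕ) : moritaGamma p n = moritaGammaNat p n :=
  let : UniformSpace ℕ := .comap (Nat.cast : ℕ → ℤ_[p]) inferInstance
  uniformly_extend_of_ind ⟨rfl⟩ PadicInt.denseRange_natCast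
    (uniformContinuous_moritaGammaNat hp) n

theorem continuous_moritaGamma (hp : Odd p) : Continuous (moritaGamma p) :=
  let : UniformSpace ℕ := .comap (Nat.cast : ℕ → ℤ_[p]) inferInstance
  (uniformContinuous_uniformly_extend ⟨rfl⟩ PadicInt.denseRange_natCast
    (uniformContinuous_moritaGammaNat hp)).continuous

theorem sub_dvd_moritaGamma_sub (hp : Odd p) (x y : ℤ_[p]) :
    x - y ∣ moritaGamma p x - moritaGamma p y := by
  have hΓ := continuous_moritaGamma hp
  rw [← norm_le_norm_iff_dvd]
  refine isClosed_property2 (p := fun x y => ‖moritaGamma p x - moritaGamma p y‖ ≤ ‖x - y‖)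
    PadicInt.denseRange_natCast (isClosed_le (by fun_prop) (by fun_prop)) (fun m n => ?_) x y
  rw [norm_le_norm_iff_dvd, moritaGamma_natCast hp, moritaGamma_natCast hp]
  exact natCast_sub_dvd_moritaGammaNat_sub hp m n

theorem moritaGamma_zero (hp : Odd p) : moritaGamma p 0 = 1 := by
  simpa [moritaGammaNat_zero] using moritaGamma_natCast hp 0

theorem moritaGamma_add_one (hp : Odd p) (x : ℤ_[p]) :
    moritaGamma p (x + 1) = -unitPart x * moritaGamma p x := by
  have hΓ := continuous_moritaGamma hp
  have hu := continuous_unitPart (p := p)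
  refine congrFun (PadicInt.denseRange_natCast.equalizer (g := fun x => moritaGamma p (x + 1))
    (h := fun x => -unitPart x * moritaGamma p x) (by fun_prop) (by fun_prop) ?_) x
  funext n
  simp only [Function.comp_apply]
  rw [← Nat.cast_succ, moritaGamma_natCast hp, moritaGamma_natCast hp,
    moritaGammaNat_succ isUnit_natCast_padicInt]

theorem moritaGamma_add_natCast (hp : Odd p) (x : ℤ_[p]) (n : ℕ) :
    moritaGamma p (x + n) =
      (-1) ^ n * (∏ i ∈ range n, unitPart (x + i)) * moritaGamma p x := by
  induction n with
  | zero => simp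
  | succ n ih =>
    rw [Nat.cast_succ, ← add_assoc, moritaGamma_add_one hp, ih, prod_range_succ]
    ring

theorem moritaGamma_sq_mul_sq (hp : Odd p) (x : ℤ_[p]) :
    moritaGamma p x ^ 2 * moritaGamma p (1 - x) ^ 2 = 1 := by
  have hΓ := continuous_moritaGamma hp
  refine isClosed_property (p := fun x => moritaGamma p x ^ 2 * moritaGamma p (1 - x) ^ 2 = 1)
    PadicInt.denseRange_natCast (isClosed_eq (by fun_prop) continuous_const) (fun n => ?_) x
  induction n with
  | zero =>
    have h1 : moritaGamma p (0 + 1) = -1 := by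
      rw [moritaGamma_add_one hp, unitPart_of_not_isUnit not_isUnit_zero, moritaGamma_zero hp,
        mul_one]
    rw [Nat.cast_zero, sub_zero, ← zero_add (1 : ℤ_[p]), h1, moritaGamma_zero hp]
    ring
  | succ n ih =>
    have hneg : moritaGamma p (1 - n) = -unitPart (-n : ℤ_[p]) * moritaGamma p (-n) := by
      rw [← moritaGamma_add_one hp, neg_add_eq_sub]
    rw [Nat.cast_succ, moritaGamma_add_one hp, sub_add_cancel_right]
    rw [hneg] at ih
    linear_combination ih - unitPart_neg_sq (n : ℤ_[p]) *
      (moritaGamma p n ^ 2 * moritaGamma p (-n) ^ 2)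

end MoritaGamma

/-! ### The Gamma function modulo `p³` -/

section UnitShift

open Polynomial

theorem prod_univ_X_add_C (K : Type*) [Field K] [Fintype K] :
    ∏ x : K, (X + C x) = X ^ Fintype.card K - X := by
  have hcard : 1 < Fintype.card K := Fintype.one_lt_card
  have hsplit : (Multiset.map (fun x : K => X - C x) univ.val).prod = X ^ Fintype.card K - X := by
    rw [← FiniteField.roots_X_pow_card_sub_X]
    refine prod_multiset_X_sub_C_of_monic_of_roots_card_eq (monic_X_pow_sub ?_) ?_
    · rw [degree_X]
      exact_mod_cast hcard
    · rw [FiniteField.roots_X_pow_card_sub_X, FiniteField.X_pow_card_sub_X_natDegree_eq K hcard]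
      rfl
  rw [← hsplit]
  exact Fintype.prod_equiv (Equiv.neg K) _ (fun x => X - C x) (by simp)

open Classical in
/-- The polynomial `∏ (X + (m + k))` over the `k < n` for which `m + k` is a unit. Its value at an
element `z` of the Jacobson radical is `∏_{k < n} unitPart (z + m + k)`. -/
noncomputable def unitShiftPoly {R : Type*} [CommRing R] (n : ℕ) (m : R) : R[X] :=
  ∏ k ∈ range n, if IsUnit (m + k) then X + C (m + k) else 1

theorem map_unitShiftPoly {R S : Type*} [CommRing R] [CommRing S] (φ : R →+* S) [IsLocalHom φ]
    (n : ℕ) (m : R) : (unitShiftPoly n m).map φ = unitShiftPoly n (φ m) := by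
  rw [unitShiftPoly, unitShiftPoly, Polynomial.map_prod]
  refine prod_congr rfl fun k _ => ?_
  have hunit : IsUnit (φ m + k) ↔ IsUnit (m + k) := by
    rw [← map_natCast φ, ← map_add, isUnit_map_iff]
  by_cases hk : IsUnit (m + k) <;> simp [hunit, hk]

theorem unitShiftPoly_zmod {p : ℕ} [Fact p.Prime] (m : ZMod p) :
    unitShiftPoly p m = X ^ (p - 1) - 1 := by
  classical
  have hshift : unitShiftPoly p m = ∏ x : ZMod p, if x = 0 then 1 else X + C x := by
    let g (x : ZMod p) : (ZMod p)[X] := if x = 0 then 1 else X + C x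
    calc unitShiftPoly p m = ∏ k ∈ range p, g (m + k) :=
          prod_congr rfl fun k _ => by by_cases hk : m + k = 0 <;> simp [g, hk]
      _ = ∏ x : ZMod p, g (m + x) := prod_range_natCast_zmod p fun x => g (m + x)
      _ = ∏ x : ZMod p, g x := Fintype.prod_equiv (Equiv.addLeft m) _ g fun _ => rfl
  have hX : (∏ x : ZMod p, if x = 0 then X + C x else (1 : (ZMod p)[X])) = X := by simp
  have hprod : ∏ x : ZMod p, (X + C x) = X * unitShiftPoly p m := by
    calc ∏ x : ZMod p, (X + C x) =
          ∏ x : ZMod p, (if x = 0 then X + C x else 1) * (if x = 0 then 1 else X + C x) :=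
          prod_congr rfl fun x _ => by split_ifs <;> simp
      _ = X * unitShiftPoly p m := by rw [prod_mul_distrib, hX, hshift]
  apply mul_left_cancel₀ (X_ne_zero : (X : (ZMod p)[X]) ≠ 0)
  rw [← hprod, prod_univ_X_add_C, ZMod.card, mul_sub, mul_one, mul_pow_sub_one (NeZero.ne p)]

theorem pow_dvd_eval_sub_sum_coeff {R : Type*} [CommRing R] (P : R[X]) (n : ℕ) (x : R) :
    x ^ n ∣ P.eval x - ∑ i ∈ range n, P.coeff i * x ^ i := by
  have hdvd : X ^ n ∣ P - ∑ i ∈ range n, C (P.coeff i) * X ^ i :=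
    X_pow_dvd_iff.mpr fun d hd => by simp [hd]
  simpa [eval_finsetSum] using eval_dvd (x := x) hdvd

end UnitShift

section Taylor

open Polynomial

variable {p : ℕ} [Fact p.Prime]

theorem toZMod_eq_zero_iff_prime_dvd {x : ℤ_[p]} : PadicInt.toZMod x = 0 ↔ (p : ℤ_[p]) ∣ x := by
  rw [← RingHom.mem_ker, PadicInt.ker_toZMod, PadicInt.maximalIdeal_eq_span_p,
    Ideal.mem_span_singleton]

theorem prime_dvd_coeff_unitShiftPoly_sub (m : ℤ_[p]) (i : ℕ) :
    (p : ℤ_[p]) ∣ (unitShiftPoly p m).coeff i - (X ^ (p - 1) - 1 : ℤ_[p][X]).coeff i := by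
  have : IsLocalHom (PadicInt.toZMod (p := p)) := .of_surjective _ (ZMod.ringHom_surjective _)
  rw [← toZMod_eq_zero_iff_prime_dvd, map_sub, ← coeff_map, ← coeff_map, map_unitShiftPoly,
    unitShiftPoly_zmod]
  simp

theorem eval_unitShiftPoly (m z : ℤ_[p]) (n : ℕ) :
    (unitShiftPoly n m).eval (p * z) = ∏ k ∈ range n, unitPart (m + p * z + k) := by
  rw [unitShiftPoly, eval_prod]
  refine prod_congr rfl fun k _ => ?_
  have hunit : IsUnit (m + p * z + k) ↔ IsUnit (m + k) :=
    isUnit_iff_of_prime_dvd_sub ⟨z, by ring⟩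
  by_cases hk : IsUnit (m + k)
  · rw [if_pos hk, unitPart_of_isUnit (hunit.mpr hk), eval_add, eval_X, eval_C]
    ring
  · rw [if_neg hk, unitPart_of_not_isUnit (hunit.not.mpr hk), eval_one]

theorem exists_moritaGamma_add_prime (hp : Odd p) (hp5 : 5 ≤ p) (m : ℤ_[p]) :
    ∃ w c : ℤ_[p], ∀ z : ℤ_[p], (p : ℤ_[p]) ^ 3 ∣
      moritaGamma p (m + p * (z + 1)) -
        (1 + p * w + p ^ 2 * c * z) * moritaGamma p (m + p * z) := by
  have hcoeff (i : ℕ) (hi : i < 3) :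
      (p : ℤ_[p]) ∣ (unitShiftPoly p m).coeff i + if i = 0 then 1 else 0 := by
    simpa [coeff_X_pow, coeff_one, show i ≠ p - 1 by omega]
      using prime_dvd_coeff_unitShiftPoly_sub m i
  obtain ⟨w, hw⟩ := hcoeff 0 (by simp)
  obtain ⟨c, hc⟩ := hcoeff 1 (by simp)
  obtain ⟨d, hd⟩ := hcoeff 2 (by simp)
  simp only [if_true, one_ne_zero, if_false, add_zero, OfNat.ofNat_ne_zero] at hw hc hd
  refine ⟨-w, -c, fun z => ?_⟩
  have hΓ : moritaGamma p (m + p * (z + 1)) =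
      -(unitShiftPoly p m).eval (p * z) * moritaGamma p (m + p * z) := by
    rw [eval_unitShiftPoly, mul_add_one, ← add_assoc, moritaGamma_add_natCast hp, hp.neg_one_pow,
      neg_one_mul]
  obtain ⟨r, hr⟩ := pow_dvd_eval_sub_sum_coeff (unitShiftPoly p m) 3 (p * z)
  simp only [sum_range_succ, range_zero, sum_empty] at hr
  refine ⟨-(z ^ 3 * r + d * z ^ 2) * moritaGamma p (m + p * z), ?_⟩
  rw [hΓ]
  linear_combination -(hr + hw + p * z * hc + (p * z) ^ 2 * hd) * moritaGamma p (m + p * z)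

theorem isUnit_two_padicInt (hp : Odd p) : IsUnit (2 : ℤ_[p]) :=
  (isUnit_natCast_padicInt 2).mpr (not_prime_dvd_two hp)

theorem exists_polynomial_moritaGamma (hp : Odd p) (hp5 : 5 ≤ p) (m : ℤ_[p]) :
    ∃ Q : ℤ_[p][X], ∀ z : ℤ_[p], (p : ℤ_[p]) ^ 3 ∣
      moritaGamma p (m + p * z) - Q.eval (p * z) := by
  obtain ⟨w, c, hstep⟩ := exists_moritaGamma_add_prime hp hp5 m
  -- Modulo `p³`, the first `n` steps multiply to `1 + p w n + p² (w² + c) n (n - 1) / 2`.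
  obtain ⟨e, he⟩ : ∃ e, w ^ 2 + c = 2 * e := (isUnit_two_padicInt hp).dvd
  let Q : ℤ_[p][X] := C (moritaGamma p m) * (1 + C (w - p * e) * X + C e * X ^ 2)
  have hQ (z : ℤ_[p]) : Q.eval z = moritaGamma p m * (1 + (w - p * e) * z + e * z ^ 2) := by
    simp [Q]
  have hnat (n : ℕ) : (p : ℤ_[p]) ^ 3 ∣ moritaGamma p (m + p * n) - Q.eval (p * n : ℤ_[p]) := by
    simp only [hQ]
    induction n with
    | zero => simp
    | succ n ih =>
      obtain ⟨u, hu⟩ := ih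
      obtain ⟨v, hv⟩ := hstep n
      refine ⟨v + (1 + p * w + p ^ 2 * c * n) * u + moritaGamma p m *
        ((w * c * n ^ 2 + w * e * n * (n - 1)) + p * c * n * e * n * (n - 1)), ?_⟩
      push_cast
      linear_combination hv + (1 + p * w + p ^ 2 * c * n) * hu +
        moritaGamma p m * (p : ℤ_[p]) ^ 2 * n * he
  refine ⟨Q, fun z => ?_⟩
  have hmod : (p : ℤ_[p]) ^ 3 ∣ p * z - p * z.appr 3 := by
    rw [← mul_sub, ← Ideal.mem_span_singleton]
    exact Ideal.mul_mem_left _ _ (PadicInt.appr_spec 3 z)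
  have hΓ := hmod.trans <|
    (dvd_of_eq (add_sub_add_left_eq_sub _ _ m).symm).trans <| sub_dvd_moritaGamma_sub hp _ _
  have hQmod := hmod.trans (sub_dvd_eval_sub (p * z) (p * z.appr 3) Q)
  convert dvd_add hΓ (dvd_sub (hnat (z.appr 3)) hQmod) using 1
  ring

end Taylor

/-! ### Polynomial functions modulo `q ^ n` -/

section PolynomialMod

open Polynomial Polynomial.Bivariate

variable {R : Type*} [CommRing R]

/-- The functions of `(x, y)` that agree modulo `q ^ n` with a polynomial in `q * x` and `q * y`. -/
def polynomialMod (q : R) (n : ℕ) : Subalgebra R (R × R → R) where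
  carrier := {f | ∃ P : R[X][Y], ∀ v, q ^ n ∣ f v - P.evalEval (q * v.1) (q * v.2)}
  mul_mem' := by
    rintro f g ⟨P, hP⟩ ⟨Q, hQ⟩
    exact ⟨P * Q, fun v => by
      simpa only [evalEval_mul, Pi.mul_apply] using dvd_mul_sub_mul (hP v) (hQ v)⟩
  add_mem' := by
    rintro f g ⟨P, hP⟩ ⟨Q, hQ⟩
    exact ⟨P + Q, fun v => by
      simpa only [evalEval_add, Pi.add_apply, add_sub_add_comm] using dvd_add (hP v) (hQ v)⟩
  algebraMap_mem' c := ⟨CC c, fun v => by simp⟩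

variable {q : R} {n : ℕ}

theorem mul_fst_mem_polynomialMod : (fun v => q * v.1) ∈ polynomialMod q n :=
  ⟨C X, fun v => by simp [evalEval_C]⟩

theorem mul_snd_mem_polynomialMod : (fun v => q * v.2) ∈ polynomialMod q n :=
  ⟨X, fun v => by simp⟩

theorem mul_neg_add_mem_polynomialMod : (fun v => q * -(v.1 + v.2)) ∈ polynomialMod q n := by
  refine ⟨-(C X + X), fun v => ?_⟩
  rw [evalEval_neg, evalEval_add, evalEval_C, eval_X, evalEval_X]
  exact ⟨0, by ring⟩

theorem mem_polynomialMod_of_dvd {f g : R × R → R} (hg : g ∈ polynomialMod q n)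
    (h : ∀ v, q ^ n ∣ f v - g v) : f ∈ polynomialMod q n := by
  obtain ⟨P, hP⟩ := hg
  exact ⟨P, fun v => by simpa only [sub_add_sub_cancel] using dvd_add (h v) (hP v)⟩

theorem const_add_mem {ι : Type*} {S : Subalgebra R (ι → R)} {f : ι → R} (hf : f ∈ S) (c : R) :
    (fun v => c + f v) ∈ S :=
  add_mem (S.algebraMap_mem c) hf

theorem eval_comp_mem {ι : Type*} {S : Subalgebra R (ι → R)} {f : ι → R} (hf : f ∈ S) (Q : R[X]) :
    (fun v => Q.eval (f v)) ∈ S := by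
  convert (aeval (⟨f, hf⟩ : S) Q).2 using 1
  ext v
  rw [← Subalgebra.aeval_coe, aeval_fn_apply, coe_aeval_eq_eval]

theorem exists_evalEval_mixed_difference (P : R[X][Y]) (x y : R) :
    ∃ r s : R, P.evalEval x y - P.evalEval x 0 - P.evalEval 0 y + P.evalEval 0 0 =
      x * y * ((P.coeff 1).coeff 1 + x * r + y * s) := by
  have hY (Q : R[X][Y]) (x y : R) :
      Q.evalEval x y = Q.divX.evalEval x y * y + (Q.coeff 0).eval x := by
    conv_lhs => rw [← divX_mul_X_add Q]
    rw [evalEval_add, evalEval_mul, evalEval_X, evalEval_C]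
  have hX (Q : R[X]) : Q.eval x = Q.divX.eval x * x + Q.coeff 0 := by
    conv_lhs => rw [← divX_mul_X_add Q]
    rw [eval_add, eval_mul, eval_X, eval_C]
  have h₀ := hX (P.coeff 1)
  have h₁ := hX (P.coeff 1).divX
  obtain ⟨s, hs⟩ : x ∣ P.divX.divX.evalEval x y - P.divX.divX.evalEval 0 y := by
    simpa only [sub_zero, evalEval, C_0] using sub_dvd_eval_sub x 0 (P.divX.divX.eval (C y))
  refine ⟨(P.coeff 1).divX.divX.eval x, s, ?_⟩
  simp only [hY P, hY P.divX, coeff_divX, zero_add, ← coeff_zero_eq_eval_zero (P.coeff 1)] at h₁ ⊢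
  linear_combination y ^ 2 * hs + y * h₀ + x * y * h₁

theorem dvd_of_mem_polynomialMod {f : R × R → R} (hf : f ∈ polynomialMod q 3)
    (hx : ∀ x, q ^ 3 ∣ f (x, 0)) (hy : ∀ y, q ^ 3 ∣ f (0, y)) {v₀ : R × R}
    (hv₀ : IsUnit (v₀.1 * v₀.2)) (hf₀ : q ^ 3 ∣ f v₀) (v : R × R) : q ^ 3 ∣ f v := by
  obtain ⟨P, hP⟩ := hf
  have hmixed (v : R × R) : q ^ 3 ∣ f v - v.1 * v.2 * (q ^ 2 * (P.coeff 1).coeff 1) := by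
    obtain ⟨r, s, hrs⟩ := exists_evalEval_mixed_difference P (q * v.1) (q * v.2)
    obtain ⟨e, he⟩ := hP v
    obtain ⟨e₁, he₁⟩ := (dvd_sub_right (hx v.1)).mp (hP (v.1, 0))
    obtain ⟨e₂, he₂⟩ := (dvd_sub_right (hy v.2)).mp (hP (0, v.2))
    obtain ⟨e₀, he₀⟩ := (dvd_sub_right (hx 0)).mp (hP (0, 0))
    simp only [mul_zero] at he₀ he₁ he₂
    refine ⟨e + e₁ + e₂ - e₀ + v.1 * v.2 * (v.1 * r + v.2 * s), ?_⟩
    linear_combination he + he₁ + he₂ - he₀ + hrs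
  have hcoeff : q ^ 3 ∣ q ^ 2 * (P.coeff 1).coeff 1 :=
    hv₀.dvd_mul_left.mp ((dvd_sub_right hf₀).mp (hmixed v₀))
  exact (dvd_sub_left (hcoeff.mul_left _)).mp (hmixed v)

theorem dvd_sub_of_mem_polynomialMod {f g : R × R → R} (hf : f ∈ polynomialMod q 3)
    (hg : g ∈ polynomialMod q 3) (hx : ∀ x, f (x, 0) = g (x, 0)) (hy : ∀ y, f (0, y) = g (0, y))
    {v₀ : R × R} (hv₀ : IsUnit (v₀.1 * v₀.2)) (hfg : f v₀ = g v₀) (v : R × R) :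
    q ^ 3 ∣ f v - g v :=
  dvd_of_mem_polynomialMod (sub_mem hf hg) (fun x => by simp [hx]) (fun y => by simp [hy]) hv₀
    (by simp [hfg]) v

end PolynomialMod

section MoritaGammaPolynomialMod

variable {p : ℕ} [Fact p.Prime]

theorem moritaGamma_mem_polynomialMod (hp : Odd p) (hp5 : 5 ≤ p) (m : ℤ_[p])
    {f : ℤ_[p] × ℤ_[p] → ℤ_[p]} (hf : (fun v => p * f v) ∈ polynomialMod (p : ℤ_[p]) 3) :
    (fun v => moritaGamma p (m + p * f v)) ∈ polynomialMod (p : ℤ_[p]) 3 := by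
  obtain ⟨Q, hQ⟩ := exists_polynomial_moritaGamma hp hp5 m
  exact mem_polynomialMod_of_dvd (eval_comp_mem hf Q) fun v => hQ (f v)

end MoritaGammaPolynomialMod

/-! ### Exact evaluations -/

section Pochhammer

variable {p : ℕ} [Fact p.Prime]

theorem ascPochhammer_eval_eq_prod_range {R : Type*} [CommSemiring R] (n : ℕ) (x : R) :
    (ascPochhammer R n).eval x = ∏ i ∈ range n, (x + i) := by
  induction n with
  | zero => simp
  | succ n ih => rw [ascPochhammer_succ_eval, prod_range_succ, ih]

theorem coe_ascPochhammer_eval (n : ℕ) (x : ℤ_[p]) :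
    (((ascPochhammer ℤ_[p] n).eval x : ℤ_[p]) : ℚ_[p]) =
      (ascPochhammer ℚ_[p] n).eval (x : ℚ_[p]) := by
  rw [← ascPochhammer_map (PadicInt.Coe.ringHom (p := p))]
  exact (Polynomial.eval_map_apply PadicInt.Coe.ringHom x).symm

theorem isUnit_natCast_sub_prime_mul {n : ℕ} {z : ℤ_[p]} :
    IsUnit (n - p * z : ℤ_[p]) ↔ ¬ p ∣ n := by
  rw [← isUnit_natCast_padicInt]
  exact isUnit_iff_of_prime_dvd_sub ⟨-z, by ring⟩

theorem ascPochhammer_eval_natCast_sub_of_add_le {n a : ℕ} (hn : 0 < n) (hna : n + a ≤ p)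
    (z : ℤ_[p]) : (ascPochhammer ℤ_[p] a).eval (n - p * z) =
      ∏ i ∈ range a, unitPart (n - p * z + i) := by
  rw [ascPochhammer_eval_eq_prod_range]
  refine prod_congr rfl fun i hi => (unitPart_of_isUnit ?_).symm
  have hia := mem_range.mp hi
  rw [sub_add_eq_add_sub, ← Nat.cast_add, isUnit_natCast_sub_prime_mul]
  exact Nat.not_dvd_of_pos_of_lt (by lia) (by lia)

theorem ascPochhammer_eval_natCast_sub_of_lt_add {n a : ℕ} (hn : 0 < n) (hnp : n ≤ p)
    (hpn : p < n + a) (hna : n + a ≤ 2 * p) (z : ℤ_[p]) :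
    (ascPochhammer ℤ_[p] a).eval (n - p * z) =
      p * (1 - z) * ∏ i ∈ range a, unitPart (n - p * z + i) := by
  have hmem : p - n ∈ range a := mem_range.mpr (by lia)
  have hcast (i : ℕ) : (n - p * z + i : ℤ_[p]) = ((n + i : ℕ) : ℤ_[p]) - p * z := by
    push_cast
    ring
  have hnonunit : (n - p * z + (p - n : ℕ) : ℤ_[p]) = p * (1 - z) := by
    rw [hcast, Nat.add_sub_cancel' hnp]
    ring
  have hunit (i : ℕ) (hi : i ∈ (range a).erase (p - n)) : IsUnit (n - p * z + i : ℤ_[p]) := by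
    obtain ⟨hne, hia⟩ := mem_erase.mp hi
    rw [mem_range] at hia
    rw [hcast, isUnit_natCast_sub_prime_mul]
    rintro ⟨k, hk⟩
    have hk1 : k = 1 := by nlinarith
    lia
  rw [ascPochhammer_eval_eq_prod_range, ← mul_prod_erase _ _ hmem, ← mul_prod_erase _ _ hmem,
    hnonunit, unitPart_of_not_isUnit, one_mul]
  · exact congrArg _ (prod_congr rfl fun i hi => (unitPart_of_isUnit (hunit i hi)).symm)
  · rw [isUnit_iff_not_prime_dvd, not_not]
    exact dvd_mul_right _ _

end Pochhammer

section TruncSum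

variable {p : ℕ} [Fact p.Prime]

variable (p) in
/-- The truncated series `∑_{k < p} (α)_k (β)_k (γ)_k / k!³`, as a `p`-adic integer. -/
noncomputable def truncSum (α β γ : ℤ_[p]) : ℤ_[p] :=
  ∑ k ∈ range p, (ascPochhammer ℤ_[p] k).eval α * (ascPochhammer ℤ_[p] k).eval β *
    (ascPochhammer ℤ_[p] k).eval γ * Ring.inverse (k.factorial : ℤ_[p]) ^ 3

theorem truncSum_swap (α β γ : ℤ_[p]) : truncSum p α β γ = truncSum p β α γ :=
  sum_congr rfl fun k _ => by ring

theorem truncSum_rotate (α β γ : ℤ_[p]) : truncSum p α β γ = truncSum p γ α β :=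
  sum_congr rfl fun k _ => by ring

theorem truncSum_comp_mem {ι : Type*} {S : Subalgebra ℤ_[p] (ι → ℤ_[p])} {f g h : ι → ℤ_[p]}
    (hf : f ∈ S) (hg : g ∈ S) (hh : h ∈ S) : (fun v => truncSum p (f v) (g v) (h v)) ∈ S := by
  have hsum := sum_mem fun k (_ : k ∈ range p) =>
    mul_mem (mul_mem (mul_mem (eval_comp_mem hf (ascPochhammer ℤ_[p] k))
      (eval_comp_mem hg (ascPochhammer ℤ_[p] k))) (eval_comp_mem hh (ascPochhammer ℤ_[p] k)))
      (S.algebraMap_mem (Ring.inverse (k.factorial : ℤ_[p]) ^ 3))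
  convert hsum using 1
  ext v
  rw [Finset.sum_apply]
  rfl

theorem coe_truncSum (α β γ : ℤ_[p]) :
    (truncSum p α β γ : ℚ_[p]) = ∑ k ∈ range p, (ascPochhammer ℚ_[p] k).eval (α : ℚ_[p]) *
      (ascPochhammer ℚ_[p] k).eval (β : ℚ_[p]) * (ascPochhammer ℚ_[p] k).eval (γ : ℚ_[p]) /
        (k.factorial : ℚ_[p]) ^ 3 := by
  rw [truncSum, PadicInt.coe_sum]
  refine sum_congr rfl fun k hk => ?_
  have hunit : IsUnit (k.factorial : ℤ_[p]) := by
    rw [isUnit_natCast_padicInt, (Fact.out : p.Prime).dvd_factorial, not_le]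
    exact mem_range.mp hk
  have hinv :
      ((Ring.inverse (k.factorial : ℤ_[p]) : ℤ_[p]) : ℚ_[p]) = (k.factorial : ℚ_[p])⁻¹ := by
    have hmul : Ring.inverse (k.factorial : ℤ_[p]) * k.factorial = 1 :=
      Ring.inverse_mul_cancel _ hunit
    exact eq_inv_of_mul_eq_one_left (by exact_mod_cast congrArg ((↑) : ℤ_[p] → ℚ_[p]) hmul)
  simp only [PadicInt.coe_mul, PadicInt.coe_pow, coe_ascPochhammer_eval, hinv, div_eq_mul_inv,
    inv_pow]

theorem truncHypergeometric_eq_coe_truncSum (α β : ℤ_[p]) :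
    truncHypergeometric ![(α : ℚ_[p]), (β : ℚ_[p]), 1 - (α : ℚ_[p]) - (β : ℚ_[p])] ![1, 1] 1
      (p - 1) = (truncSum p α β (1 - α - β) : ℚ_[p]) := by
  rw [coe_truncSum, truncHypergeometric, Nat.sub_add_cancel (Fact.out : p.Prime).one_le]
  refine sum_congr rfl fun k _ => ?_
  rw [Fin.prod_univ_three, Fin.prod_univ_two]
  simp only [Matrix.cons_val_zero, Matrix.cons_val_one, Matrix.cons_val, ascPochhammer_eval_one,
    one_pow, PadicInt.coe_sub, PadicInt.coe_one]
  field_simp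

theorem truncSum_neg_natCast_mul_factorial_sq {a : ℕ} (ha : a < p) {β γ : ℤ_[p]}
    (hγ : γ = 1 - β + a) :
    truncSum p (-a) β γ * a.factorial ^ 2 = (ascPochhammer ℤ_[p] a).eval (1 - β) ^ 2 := by
  have hfact : (a.factorial : ℚ_[p]) ≠ 0 := Nat.cast_ne_zero.mpr a.factorial_ne_zero
  have hone (k : ℕ) : (1 : ℚ_[p]) + k ≠ 0 := by
    rw [add_comm]
    exact Nat.cast_add_one_ne_zero k
  have hT : (truncSum p (-a) β γ : ℚ_[p]) =
      ∑ k ∈ range p, saalschutzTerm (a : ℚ_[p]) β 1 1 k := by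
    rw [coe_truncSum]
    refine sum_congr rfl fun k _ => ?_
    rw [saalschutzTerm, ascPochhammer_eval_one, hγ]
    push_cast
    ring_nf
  have hT' := hT.trans (sum_saalschutzTerm hone hone (β : ℚ_[p]) ha)
  rw [ascPochhammer_eval_one] at hT'
  apply Subtype.coe_injective
  push_cast [coe_ascPochhammer_eval]
  rw [hT']
  field_simp

end TruncSum

section GammaProdSq

variable {p : ℕ} [Fact p.Prime]

variable (p) in
/-- The symmetric form `(Γ_p(α) Γ_p(β) Γ_p(γ))²` which the Gamma quotient
`Γ_p(1 - α - β)² / (Γ_p(1 - α)² Γ_p(1 - β)²)` takes when `α + β + γ = 1`. -/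
noncomputable def gammaProdSq (α β γ : ℤ_[p]) : ℤ_[p] :=
  (moritaGamma p α * moritaGamma p β * moritaGamma p γ) ^ 2

theorem gammaProdSq_swap (α β γ : ℤ_[p]) : gammaProdSq p α β γ = gammaProdSq p β α γ := by
  simp only [gammaProdSq, mul_comm (moritaGamma p α)]

theorem gammaProdSq_rotate (α β γ : ℤ_[p]) : gammaProdSq p α β γ = gammaProdSq p γ α β := by
  simp only [gammaProdSq, mul_comm, mul_left_comm]

theorem dvd_gammaProdSq_sub (hp : Odd p) {d α β γ α' β' γ' : ℤ_[p]} (hα : d ∣ α - α')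
    (hβ : d ∣ β - β') (hγ : d ∣ γ - γ') : d ∣ gammaProdSq p α β γ - gammaProdSq p α' β' γ' := by
  have hΓ {x y : ℤ_[p]} (h : d ∣ x - y) := h.trans (sub_dvd_moritaGamma_sub hp x y)
  exact (dvd_mul_sub_mul (dvd_mul_sub_mul (hΓ hα) (hΓ hβ)) (hΓ hγ)).trans
    (sub_dvd_pow_sub_pow _ _ 2)

theorem coe_gammaProdSq (hp : Odd p) (α β γ : ℤ_[p]) :
    (gammaProdSq p α β γ : ℚ_[p]) = (moritaGamma p γ : ℚ_[p]) ^ 2 /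
      ((moritaGamma p (1 - α) : ℚ_[p]) ^ 2 * (moritaGamma p (1 - β) : ℚ_[p]) ^ 2) := by
  have hinv (x : ℤ_[p]) :
      (moritaGamma p x : ℚ_[p]) ^ 2 = ((moritaGamma p (1 - x) : ℚ_[p]) ^ 2)⁻¹ :=
    eq_inv_of_mul_eq_one_left <| by
      exact_mod_cast congrArg Subtype.val (moritaGamma_sq_mul_sq hp x)
  rw [gammaProdSq]
  push_cast
  rw [mul_pow, mul_pow, hinv α, hinv β, div_eq_mul_inv, mul_inv, mul_comm]

theorem moritaGamma_add_natCast_sq (hp : Odd p) (x : ℤ_[p]) (n : ℕ) :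
    moritaGamma p (x + n) ^ 2 = (∏ i ∈ range n, unitPart (x + i)) ^ 2 * moritaGamma p x ^ 2 := by
  rw [moritaGamma_add_natCast hp, mul_pow, mul_pow, pow_right_comm, neg_one_sq, one_pow, one_mul]

theorem moritaGamma_one_add_natCast_sq (hp : Odd p) {a : ℕ} (ha : a < p) :
    moritaGamma p (1 + a) ^ 2 = (a.factorial : ℤ_[p]) ^ 2 := by
  have hone : moritaGamma p 1 ^ 2 = 1 := by
    simpa [moritaGamma_zero hp] using moritaGamma_sq_mul_sq hp 1
  have hprod := ascPochhammer_eval_natCast_sub_of_add_le (p := p) one_pos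
    (Nat.one_add_le_iff.mpr ha) 0
  rw [mul_zero, sub_zero, Nat.cast_one, ascPochhammer_eval_one] at hprod
  rw [moritaGamma_add_natCast_sq hp, hone, mul_one, hprod]

theorem truncSum_eq_sq_mul_gammaProdSq (hp : Odd p) {a : ℕ} (ha : a < p) {α β γ c : ℤ_[p]}
    (hα : α = -a) (hγ : α + β + γ = 1)
    (hc : (ascPochhammer ℤ_[p] a).eval (1 - β) = c * ∏ i ∈ range a, unitPart (1 - β + i)) :
    truncSum p α β γ = c ^ 2 * gammaProdSq p α β γ := by
  have hγ' : γ = 1 - β + a := by linear_combination hγ - hα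
  have hT : truncSum p α β γ * moritaGamma p (1 - α) ^ 2 =
      (c * ∏ i ∈ range a, unitPart (1 - β + i)) ^ 2 := by
    rw [hα, sub_neg_eq_add, moritaGamma_one_add_natCast_sq hp ha, ← hc]
    exact truncSum_neg_natCast_mul_factorial_sq ha hγ'
  have hΓγ : moritaGamma p γ ^ 2 =
      (∏ i ∈ range a, unitPart (1 - β + i)) ^ 2 * moritaGamma p (1 - β) ^ 2 := by
    rw [hγ', moritaGamma_add_natCast_sq hp]
  have hΓα := moritaGamma_sq_mul_sq hp α
  have hΓβ := moritaGamma_sq_mul_sq hp β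
  rw [gammaProdSq, mul_pow, mul_pow, hΓγ]
  linear_combination moritaGamma p α ^ 2 * hT - truncSum p α β γ * hΓα -
    moritaGamma p α ^ 2 * (c * ∏ i ∈ range a, unitPart (1 - β + i)) ^ 2 * hΓβ

theorem truncSum_eq_gammaProdSq (hp : Odd p) {a b : ℕ} (hab : a + b < p) {α β γ y : ℤ_[p]}
    (hα : α = -a) (hβ : β = -b + p * y) (hγ : α + β + γ = 1) :
    truncSum p α β γ = gammaProdSq p α β γ := by
  have hβ' : 1 - β = (1 + b : ℕ) - p * y := by
    rw [hβ]
    push_cast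
    ring
  have heval := ascPochhammer_eval_natCast_sub_of_add_le (p := p) (n := 1 + b) (a := a)
    (by lia) (by lia) y
  simpa using truncSum_eq_sq_mul_gammaProdSq hp (c := 1) (by lia) hα hγ
    (by rw [hβ', heval, one_mul])

theorem truncSum_eq_prime_sq_mul_gammaProdSq (hp : Odd p) {a b : ℕ} (ha : a < p) (hb : b < p)
    (hab : p ≤ a + b) {α β γ y : ℤ_[p]} (hα : α = -a) (hβ : β = -b + p * y)
    (hγ : α + β + γ = 1) :
    truncSum p α β γ = (p * (1 - y)) ^ 2 * gammaProdSq p α β γ := by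
  have hβ' : 1 - β = (1 + b : ℕ) - p * y := by
    rw [hβ]
    push_cast
    ring
  refine truncSum_eq_sq_mul_gammaProdSq hp ha hα hγ ?_
  rw [hβ', ascPochhammer_eval_natCast_sub_of_lt_add (by lia) (by lia) (by lia) (by lia)]

end GammaProdSq

/-! ### The congruences -/

section Congruence

variable {p : ℕ} [Fact p.Prime]

theorem truncSum_mem_polynomialMod (r₁ r₂ r₃ : ℤ_[p]) (n : ℕ) :
    (fun v => truncSum p (r₁ + p * v.1) (r₂ + p * v.2) (r₃ + p * -(v.1 + v.2))) ∈
      polynomialMod (p : ℤ_[p]) n :=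
  truncSum_comp_mem (const_add_mem mul_fst_mem_polynomialMod _)
    (const_add_mem mul_snd_mem_polynomialMod _) (const_add_mem mul_neg_add_mem_polynomialMod _)

theorem gammaProdSq_mem_polynomialMod (hp : Odd p) (hp5 : 5 ≤ p) (r₁ r₂ r₃ : ℤ_[p]) :
    (fun v => gammaProdSq p (r₁ + p * v.1) (r₂ + p * v.2) (r₃ + p * -(v.1 + v.2))) ∈
      polynomialMod (p : ℤ_[p]) 3 :=
  pow_mem (mul_mem (mul_mem (moritaGamma_mem_polynomialMod hp hp5 _ mul_fst_mem_polynomialMod)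
    (moritaGamma_mem_polynomialMod hp hp5 _ mul_snd_mem_polynomialMod))
    (moritaGamma_mem_polynomialMod hp hp5 _ mul_neg_add_mem_polynomialMod)) 2

theorem sq_mul_gammaProdSq_mem_polynomialMod (hp : Odd p) (r₁ r₂ r₃ : ℤ_[p]) :
    (fun v => p ^ 2 * ((v.1 - 1) ^ 2 + (v.2 - 1) ^ 2 + v.1 * v.2 - 1) *
        gammaProdSq p (r₁ + p * v.1) (r₂ + p * v.2) (r₃ + p * -(v.1 + v.2))) ∈
      polynomialMod (p : ℤ_[p]) 3 := by
  let S := polynomialMod (p : ℤ_[p]) 3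
  let F (v : ℤ_[p] × ℤ_[p]) : ℤ_[p] :=
    p ^ 2 * ((v.1 - 1) ^ 2 + (v.2 - 1) ^ 2 + v.1 * v.2 - 1)
  have hF : F ∈ S := by
    have hx : (fun v : ℤ_[p] × ℤ_[p] => p * v.1) ∈ S := mul_fst_mem_polynomialMod
    have hy : (fun v : ℤ_[p] × ℤ_[p] => p * v.2) ∈ S := mul_snd_mem_polynomialMod
    have hc (c : ℤ_[p]) : (fun _ : ℤ_[p] × ℤ_[p] => c) ∈ S := S.algebraMap_mem c
    convert sub_mem (add_mem (add_mem (pow_mem (sub_mem hx (hc p)) 2)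
      (pow_mem (sub_mem hy (hc p)) 2)) (mul_mem hx hy)) (hc (p ^ 2)) using 1
    ext v
    simp only [F, Pi.add_apply, Pi.sub_apply, Pi.mul_apply, Pi.pow_apply]
    ring
  have hconst : (fun _ : ℤ_[p] × ℤ_[p] => gammaProdSq p r₁ r₂ r₃) ∈ S := S.algebraMap_mem _
  refine mem_polynomialMod_of_dvd (mul_mem hF hconst) fun v => ?_
  have hG : (p : ℤ_[p]) ∣ gammaProdSq p (r₁ + p * v.1) (r₂ + p * v.2) (r₃ + p * -(v.1 + v.2)) -
      gammaProdSq p r₁ r₂ r₃ :=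
    dvd_gammaProdSq_sub hp (by simp) (by simp) (by simp)
  rw [Pi.mul_apply, ← mul_sub, pow_succ]
  exact mul_dvd_mul (dvd_mul_right _ _) hG

theorem truncSum_congr_gammaProdSq (hp : Odd p) (hp3 : p ≠ 3) {a b : ℕ} (hab : a + b < p)
    (x y : ℤ_[p]) :
    (p : ℤ_[p]) ^ 3 ∣ truncSum p (-a + p * x) (-b + p * y) (1 + a + b + p * -(x + y)) -
      gammaProdSq p (-a + p * x) (-b + p * y) (1 + a + b + p * -(x + y)) := by
  have hp5 : 5 ≤ p := by
    have := (Fact.out : p.Prime).two_le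
    grind
  refine dvd_sub_of_mem_polynomialMod (v := (x, y)) (v₀ := (2, -1))
    (truncSum_mem_polynomialMod (-a) (-b) (1 + a + b) 3)
    (gammaProdSq_mem_polynomialMod hp hp5 (-a) (-b) (1 + a + b)) (fun x => ?_) (fun y => ?_) ?_ ?_
  · rw [truncSum_swap, gammaProdSq_swap]
    exact truncSum_eq_gammaProdSq hp (a := b) (b := a) (by lia) (by ring) rfl (by ring)
  · exact truncSum_eq_gammaProdSq hp hab (by ring) rfl (by ring)
  · simpa using isUnit_two_padicInt hp
  · obtain ⟨c, hc⟩ := Nat.exists_eq_add_of_lt hab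
    have hγ : (p : ℤ_[p]) = a + b + c + 1 := by exact_mod_cast congrArg Nat.cast hc
    rw [truncSum_rotate, gammaProdSq_rotate]
    exact truncSum_eq_gammaProdSq hp (a := c) (b := a) (by lia) (by linear_combination -hγ) rfl
      (by ring)

theorem truncSum_congr_sq_mul_gammaProdSq (hp : Odd p) {a b : ℕ} (ha : a < p) (hb : b < p)
    (hab : p ≤ a + b) (x y : ℤ_[p]) :
    (p : ℤ_[p]) ^ 3 ∣ truncSum p (-a + p * x) (-b + p * y) (1 + a + b + p * -(x + y)) -
      p ^ 2 * ((x - 1) ^ 2 + (y - 1) ^ 2 + x * y - 1) *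
        gammaProdSq p (-a + p * x) (-b + p * y) (1 + a + b + p * -(x + y)) := by
  refine dvd_sub_of_mem_polynomialMod (v := (x, y)) (v₀ := (1, 1))
    (truncSum_mem_polynomialMod (-a) (-b) (1 + a + b) 3)
    (sq_mul_gammaProdSq_mem_polynomialMod hp (-a) (-b) (1 + a + b)) (fun x => ?_) (fun y => ?_)
    (by simp) ?_
  · rw [truncSum_swap, gammaProdSq_swap, truncSum_eq_prime_sq_mul_gammaProdSq hp hb ha (by lia)
      (by ring) rfl (by ring)]
    ring
  · rw [truncSum_eq_prime_sq_mul_gammaProdSq hp ha hb hab (by ring) rfl (by ring)]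
    ring
  · obtain ⟨c, hc⟩ := Nat.exists_eq_add_of_lt (show a + b < 2 * p by lia)
    have hγ : (2 * p : ℤ_[p]) = a + b + c + 1 := by exact_mod_cast congrArg Nat.cast hc
    rw [truncSum_rotate, truncSum_eq_prime_sq_mul_gammaProdSq hp (a := c) (b := a)
      (by lia) ha (by lia) (by linear_combination -hγ) rfl (by ring)]
    ring

theorem exists_padicDash_eq (x : ℤ_[p]) :
    ∃ z : ℤ_[p], x = -((-x).zmodRepr : ℤ_[p]) + p * z ∧ padicDash x = z := by
  have hmem := PadicInt.sub_zmodRepr_mem (-x)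
  rw [PadicInt.maximalIdeal_eq_span_p, Ideal.mem_span_singleton] at hmem
  obtain ⟨z, hz⟩ := hmem
  have hx : x = -((-x).zmodRepr : ℤ_[p]) + p * -z := by linear_combination -hz
  have hp₀ : (p : ℚ_[p]) ≠ 0 := Nat.cast_ne_zero.mpr (Fact.out : p.Prime).ne_zero
  have hx' : (x : ℚ_[p]) = -((-x).zmodRepr : ℚ_[p]) + p * ((-z : ℤ_[p]) : ℚ_[p]) := by
    exact_mod_cast congrArg Subtype.val hx
  refine ⟨-z, hx, ?_⟩
  rw [padicDash, div_eq_iff hp₀]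
  linear_combination hx'

theorem PadicCongrMod.of_dvd {n : ℕ} {x y : ℤ_[p]} (h : (p : ℤ_[p]) ^ n ∣ x - y) :
    PadicCongrMod n (x : ℚ_[p]) (y : ℚ_[p]) := by
  obtain ⟨z, hz⟩ := h
  exact ⟨z, by exact_mod_cast congrArg Subtype.val hz⟩

end Congruence

theorem theorem7p1 (p : ℕ) [Fact p.Prime] (hp : Odd p) (α β : ℤ_[p]) :
    (p ≠ 3 → (-α).zmodRepr + (-β).zmodRepr ≤ p - 1 →
      PadicCongrMod 3
        (truncHypergeometric ![(α : ℚ_[p]), (β : ℚ_[p]), 1 - (α : ℚ_[p]) - (β : ℚ_[p])] ![1, 1] 1 (p - 1))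
        ((moritaGamma p (1 - α - β) : ℚ_[p]) ^ 2 /
          ((moritaGamma p (1 - α) : ℚ_[p]) ^ 2 * (moritaGamma p (1 - β) : ℚ_[p]) ^ 2))) ∧
    (p ≤ (-α).zmodRepr + (-β).zmodRepr →
      PadicCongrMod 3
        (truncHypergeometric ![(α : ℚ_[p]), (β : ℚ_[p]), 1 - (α : ℚ_[p]) - (β : ℚ_[p])] ![1, 1] 1 (p - 1))
        ((p : ℚ_[p]) ^ 2 *
          ((padicDash α - 1) ^ 2 + (padicDash β - 1) ^ 2 + padicDash α * padicDash β - 1) *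
          ((moritaGamma p (1 - α - β) : ℚ_[p]) ^ 2 /
            ((moritaGamma p (1 - α) : ℚ_[p]) ^ 2 * (moritaGamma p (1 - β) : ℚ_[p]) ^ 2)))) := by
  have hpos := (Fact.out : p.Prime).pos
  obtain ⟨x, hx, hx'⟩ := exists_padicDash_eq α
  obtain ⟨y, hy, hy'⟩ := exists_padicDash_eq β
  have ha := PadicInt.zmodRepr_lt_p (-α)
  have hb := PadicInt.zmodRepr_lt_p (-β)
  rw [truncHypergeometric_eq_coe_truncSum, ← coe_gammaProdSq hp, hx', hy']
  generalize (-α).zmodRepr = a at *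
  generalize (-β).zmodRepr = b at *
  have hγ : 1 - α - β = 1 + a + b + p * -(x + y) := by rw [hx, hy]; ring
  rw [hγ, hx, hy]
  refine ⟨fun hp3 hab => .of_dvd (truncSum_congr_gammaProdSq hp hp3 (by lia) x y), fun hab => ?_⟩
  exact_mod_cast PadicCongrMod.of_dvd (truncSum_congr_sq_mul_gammaProdSq hp ha hb hab x y)
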